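/- Let $(\Omega,\mathcal F,(\mathcal F_t)_{t=0,\dots,T},P)$ be a filtered probability space, $T,d\in\mathbb N$, and let $\Theta$ be a closed subset of a separable metric space. For each $\theta\in\Theta$ let $(S^\theta_t)_{t=0,\dots,T}$ be an $\mathbb R^d$-valued adapted process (prices of the risky assets in model $\theta$, the riskless asset being constantly $1$). Assume that whenever $\theta_n\to\theta$ in $\Theta$, there is a subsequence $(\theta_{n_k})_k$ such that $S^{\theta_{n_k}}_t\to S^\theta_t$ $P$-a.s. for every $0\le t\le T$. Let $\mathcal A$ be the set of predictable $\mathbb R^d$-valued processes $H=(H_t)_{t=1,\dots,T}$ (that is, $H_t$ is $\mathcal F_{t-1}$-measurable), and for $H\in\mathcal A$ put $(H\cdot S^\theta)_T=\sum_{t=1}^T H_t\cdot(S^\theta_t-S^\theta_{t-1})$. Assume no robust arbitrage (NRA): for every $H\in\mathcal A$, if $(H\cdot S^\theta)_T\ge 0$ $P$-a.s. for all $\theta\in\Theta$, then $(H\cdot S^\theta)_T=0$ $P$-a.s. for all $\theta\in\Theta$. Let $L^0(\mathcal F_T,P)$ be the space of $P$-a.s. equivalence classes of real $\mathcal F_T$-measurable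 random variables with the topology of convergence in probability, given by the metric $d(f,g)=E[1\wedge|f-g|]$, let $\mathbf L^0=\prod_{\theta\in\Theta}L^0(\mathcal F_T,P)$ carry the product topology, and let $\mathbf L^0_+$ be the set of $\mathbf h=(h^\theta)_\theta\in\mathbf L^0$ with $h^\theta\ge 0$ $P$-a.s. for all $\theta$. Put $$\mathbf K=\{((H\cdot S^\theta)_T)_{\theta\in\Theta}: H\in\mathcal A\},\qquad \mathbf C=\mathbf K-\mathbf L^0_+ .$$ Then the set $\mathbf C$ of hedgeable claims is closed in $\mathbf L^0$ for the product topology; that is, if a net $(\mathbf f_\alpha)_{\alpha\in I}$ in $\mathbf C$ converges to some $\mathbf f\in\mathbf L^0$, then $\mathbf f\in\mathbf C$. -/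

import Mathlib

open MeasureTheory Filter Topology
open scoped Pointwise

namespace RobustMarket

noncomputable section

/-- The space `L⁰(𝒢, P)` of `P`-a.s. equivalence classes of `𝒢`-measurable real random variables,
as an additive subgroup of the space of all classes (classes having a `𝒢`-measurable
representative). -/
def L0 {Ω : Type*} (𝒢 : MeasurableSpace Ω) {m : MeasurableSpace Ω} (P : Measure Ω) :
    AddSubgroup (Ω →ₘ[P] ℝ) where
  carrier := {f | AEStronglyMeasurable[𝒢] f P}
  add_mem' {f g} hf hg := (hf.add hg).congr (AEEqFun.coeFn_add f g).symm
  zero_mem' := (aestronglyMeasurable_const (b := (0 : ℝ))).congr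
    (AEEqFun.coeFn_zero (μ := P) (β := ℝ) (α := Ω)).symm
  neg_mem' {f} hf := hf.neg.congr (AEEqFun.coeFn_neg f).symm

theorem L0.integrable_min {Ω : Type*} {𝒢 m : MeasurableSpace Ω}
    {P : Measure Ω} [IsFiniteMeasure P] (f g : L0 𝒢 P) :
    Integrable (fun ω => min 1 |f.1 ω - g.1 ω|) P := by
  refine Integrable.of_bound (C := 1) ?_ (ae_of_all _ fun ω => ?_)
  · have h : AEStronglyMeasurable (fun ω => |f.1 ω - g.1 ω|) P :=
      (f.1.aestronglyMeasurable.sub g.1.aestronglyMeasurable).norm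
    exact (aestronglyMeasurable_const (b := (1 : ℝ))).inf h
  · rw [Real.norm_of_nonneg (le_min zero_le_one (abs_nonneg _))]
    exact min_le_left _ _

/-- The metric `d(f, g) = E[1 ∧ |f - g|]` of convergence in probability on `L⁰(𝒢, P)`. -/
instance L0.instMetricSpace {Ω : Type*} {𝒢 m : MeasurableSpace Ω}
    {P : Measure Ω} [IsFiniteMeasure P] : MetricSpace (L0 𝒢 P) where
  dist f g := ∫ ω, min 1 |f.1 ω - g.1 ω| ∂P
  dist_self f := by simp
  dist_comm f g := by simp only [abs_sub_comm]
  dist_triangle f g h := by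
    rw [← integral_add (L0.integrable_min f g) (L0.integrable_min g h)]
    refine integral_mono (L0.integrable_min f h)
      ((L0.integrable_min f g).add (L0.integrable_min g h)) fun ω => ?_
    have h1 := abs_sub_le (f.1 ω) (g.1 ω) (h.1 ω)
    have h2 := abs_nonneg (f.1 ω - g.1 ω)
    have h3 := abs_nonneg (g.1 ω - h.1 ω)
    simp only
    rcases min_cases 1 |f.1 ω - h.1 ω| with a | a <;>
    rcases min_cases 1 |f.1 ω - g.1 ω| with b | b <;>
    rcases min_cases 1 |g.1 ω - h.1 ω| with c | c <;> linarith
  eq_of_dist_eq_zero {f g} h := by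
    have h0 := (integral_eq_zero_iff_of_nonneg
      (fun ω => le_min zero_le_one (abs_nonneg _)) (L0.integrable_min f g)).1 h
    refine Subtype.ext (AEEqFun.ext ?_)
    filter_upwards [h0] with ω hω
    have hω' : min 1 |f.1 ω - g.1 ω| = 0 := hω
    rcases min_cases 1 |f.1 ω - g.1 ω| with a | a
    · linarith
    · exact sub_eq_zero.1 (abs_eq_zero.1 (a.1.symm.trans hω'))

/-- Trading strategies: `ℝᵈ`-valued predictable processes. For `t : Fin T`, the vector `H t` is the
position held over the period from date `t` to date `t + 1`; it is known at date `t`. -/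
def IsStrategy {Ω : Type*} {m : MeasurableSpace Ω} {T d : ℕ} (ℱ : Filtration (Fin (T + 1)) m)
    (H : Fin T → Ω → EuclideanSpace ℝ (Fin d)) : Prop :=
  ∀ t : Fin T, StronglyMeasurable[ℱ t.castSucc] (H t)

/-- The terminal gain `(H · S)_T = ∑ₜ Hₜ ΔSₜ`. -/
def gain {Ω : Type*} {T d : ℕ} (H : Fin T → Ω → EuclideanSpace ℝ (Fin d))
    (S : Fin (T + 1) → Ω → EuclideanSpace ℝ (Fin d)) (ω : Ω) : ℝ :=
  ∑ t : Fin T, inner ℝ (H t ω) (S t.succ ω - S t.castSucc ω)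

/-- No robust arbitrage. The price of the riskless asset is constantly `1`, so every predictable
`H` determines a self-financing strategy. -/
def NRA {Ω ι : Type*} {m : MeasurableSpace Ω} {T d : ℕ} (ℱ : Filtration (Fin (T + 1)) m)
    (P : Measure Ω) (S : ι → Fin (T + 1) → Ω → EuclideanSpace ℝ (Fin d)) : Prop :=
  ∀ H : Fin T → Ω → EuclideanSpace ℝ (Fin d), IsStrategy ℱ H →
    (∀ θ, ∀ᵐ ω ∂P, 0 ≤ gain H (S θ) ω) → ∀ θ, ∀ᵐ ω ∂P, gain H (S θ) ω = 0

/-- The product space `∏_θ L⁰(ℱ_T, P)`; it carries the product topology. -/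
abbrev Claims {Ω : Type*} (ι : Type*) {m : MeasurableSpace Ω} {T : ℕ}
    (ℱ : Filtration (Fin (T + 1)) m) (P : Measure Ω) : Type _ :=
  ι → L0 (ℱ (Fin.last T)) P

/-- The set `𝐊` of attainable payoffs `((H · S^θ)_T)_θ`. -/
def attainable {Ω ι : Type*} {m : MeasurableSpace Ω} {T d : ℕ} (ℱ : Filtration (Fin (T + 1)) m)
    (P : Measure Ω) (S : ι → Fin (T + 1) → Ω → EuclideanSpace ℝ (Fin d)) :
    Set (Claims ι ℱ P) :=
  {f | ∃ H : Fin T → Ω → EuclideanSpace ℝ (Fin d), IsStrategy ℱ H ∧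
    ∀ θ, ∀ᵐ ω ∂P, (f θ).1 ω = gain H (S θ) ω}

/-- The cone `𝐋⁰₊` of families of a.s. nonnegative random variables. -/
def nonnegClaims {Ω : Type*} (ι : Type*) {m : MeasurableSpace Ω} {T : ℕ}
    (ℱ : Filtration (Fin (T + 1)) m) (P : Measure Ω) : Set (Claims ι ℱ P) :=
  {h | ∀ θ, ∀ᵐ ω ∂P, 0 ≤ (h θ).1 ω}

/-- The set `𝐂 = 𝐊 - 𝐋⁰₊` of hedgeable claims. -/
def hedgeable {Ω ι : Type*} {m : MeasurableSpace Ω} {T d : ℕ} (ℱ : Filtration (Fin (T + 1)) m)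
    (P : Measure Ω) (S : ι → Fin (T + 1) → Ω → EuclideanSpace ℝ (Fin d)) :
    Set (Claims ι ℱ P) :=
  attainable ℱ P S - nonnegClaims ι ℱ P

end

end RobustMarket

namespace RobustMarket

/-! Over uncountably many models the product topology need not be sequential, so the proof splits
into a sequential argument over countable sets of models and a passage from these to all models. Fix
a countable dense set `D` of models; by continuity, no arbitrage holds for every set of models `F ⊇
D` (`NRA.nraOn_of_dense`).

For countable `F ⊇ D`, a claim in the closure is an a.s. limit, in each model of `F`, of a sequence
of hedgeable claims. Closedness under such limits follows by backward induction on dates, with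
`nonempty_hedges_of_tendsto` as the one-period step. Replacing the claims by their tail infima makes
the hedge sets decrease, so the hedges of minimal norm have increasing norms. If these norms were
unbounded, a limit of normalised hedges would be a reversible position; subtracting the projection
onto it would shorten the minimal hedges. Hence the norms are bounded, and the parallelogram law
makes the hedges converge.

To reach all models (`exists_common_hedge`), note that the minimal hedge grows in norm with `F`. A
countable `F₀` maximises its expected norm, after a bounded transformation; further models then
cannot change the norm, nor, by strict convexity, the hedge. This hedge serves every countable set
of models, and backward induction on dates concludes. -/

/-! ### Random vectors of minimal norm -/

theorem norm_sub_sq_le_of_le_norm_midpoint {E : Type*} [NormedAddCommGroup E]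
    [InnerProductSpace ℝ E] {x y : E} {r : ℝ} (hr : 0 ≤ r) (h : r ≤ ‖(2⁻¹ : ℝ) • (x + y)‖) :
    ‖x - y‖ ^ 2 ≤ 2 * ‖x‖ ^ 2 + 2 * ‖y‖ ^ 2 - 4 * r ^ 2 := by
  have h1 := parallelogram_law_with_norm ℝ x y
  rw [norm_smul, Real.norm_of_nonneg (by norm_num)] at h
  have h2 : (2 * r) ^ 2 ≤ ‖x + y‖ ^ 2 := pow_le_pow_left₀ (by positivity) (by linarith) 2
  nlinarith

/-- Sequences whose midpoints have norm at least `ρ n`, while the squared norms are eventually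
close to the squares of `ρ`, converge. -/
theorem exists_tendsto_of_le_norm_midpoint {E : Type*} [NormedAddCommGroup E]
    [InnerProductSpace ℝ E] [CompleteSpace E] {x : ℕ → E} {ρ : ℕ → ℝ} {r : ℝ}
    (hρ : ∀ n, 0 ≤ ρ n) (hρr : Tendsto ρ atTop (𝓝 r)) (hx : Tendsto (fun n => ‖x n‖) atTop (𝓝 r))
    (h : ∀ n k, n ≤ k → ρ n ≤ ‖(2⁻¹ : ℝ) • (x n + x k)‖) :
    ∃ y, Tendsto x atTop (𝓝 y) := by
  refine cauchySeq_tendsto_of_complete (Metric.cauchySeq_iff'.2 fun ε hε => ?_)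
  have h1 : Tendsto (fun n => ‖x n‖ ^ 2) atTop (𝓝 (r ^ 2)) := hx.pow 2
  have h2 : Tendsto (fun n => ρ n ^ 2) atTop (𝓝 (r ^ 2)) := hρr.pow 2
  have hδ : 0 < ε ^ 2 / 8 := by positivity
  have e1 : ∀ᶠ n in atTop, ‖x n‖ ^ 2 < r ^ 2 + ε ^ 2 / 8 := h1.eventually_lt_const (by linarith)
  have e2 : ∀ᶠ n in atTop, r ^ 2 - ε ^ 2 / 8 < ρ n ^ 2 := h2.eventually_const_lt (by linarith)
  obtain ⟨N, hN⟩ := eventually_atTop.1 (e1.and e2)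
  refine ⟨N, fun n hn => ?_⟩
  have h3 := norm_sub_sq_le_of_le_norm_midpoint (hρ N) (h N n hn)
  have h4 := (hN N le_rfl).1
  have h5 := (hN N le_rfl).2
  have h6 := (hN n hn).1
  rw [dist_comm, dist_eq_norm]
  exact lt_of_pow_lt_pow_left₀ 2 hε.le (by linarith)

/-- Midpoint-convex sets of `𝒢`-measurable functions which are stable under pointwise selection of
the element of smaller norm and closed under almost sure limits. -/
structure IsSelectionStable {Ω E : Type*} [NormedAddCommGroup E] [InnerProductSpace ℝ E]
    (𝒢 : MeasurableSpace Ω) {m : MeasurableSpace Ω} (P : Measure Ω) (𝓗 : Set (Ω → E)) : Prop where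
  measurable : ∀ H ∈ 𝓗, StronglyMeasurable[𝒢] H
  midpoint : ∀ H ∈ 𝓗, ∀ K ∈ 𝓗, (fun ω => (2⁻¹ : ℝ) • (H ω + K ω)) ∈ 𝓗
  select : ∀ H ∈ 𝓗, ∀ K ∈ 𝓗, (fun ω => if ‖H ω‖ < ‖K ω‖ then H ω else K ω) ∈ 𝓗
  closed : ∀ (H : ℕ → Ω → E) (K : Ω → E), (∀ n, H n ∈ 𝓗) → StronglyMeasurable[𝒢] K →
    (∀ᵐ ω ∂P, Tendsto (fun n => H n ω) atTop (𝓝 (K ω))) → K ∈ 𝓗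

theorem norm_select {E : Type*} [NormedAddCommGroup E] (x y : E) :
    ‖if ‖x‖ < ‖y‖ then x else y‖ = min ‖x‖ ‖y‖ := by
  split_ifs with h
  · exact (min_eq_left h.le).symm
  · exact (min_eq_right (not_lt.1 h)).symm

theorem integrable_arctan {Ω : Type*} {m : MeasurableSpace Ω} {P : Measure Ω} [IsFiniteMeasure P]
    {f : Ω → ℝ} (hf : AEStronglyMeasurable f P) :
    Integrable (fun ω => Real.arctan (f ω)) P := by
  refine Integrable.of_bound (C := Real.pi / 2)
    (Real.continuous_arctan.comp_aestronglyMeasurable hf) (ae_of_all _ fun ω => ?_)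
  exact abs_le.2 ⟨(Real.neg_pi_div_two_lt_arctan _).le, (Real.arctan_lt_pi_div_two _).le⟩

/-- Minimise `E[arctan ‖H‖]`: as `arctan` is bounded and strictly increasing, the functional is
always finite and detects a reduction of the norm on any set of positive measure. Stability under
selection turns a minimiser in expectation into a pointwise one. -/
theorem IsSelectionStable.exists_forall_norm_le {Ω E : Type*} [NormedAddCommGroup E]
    [InnerProductSpace ℝ E] [CompleteSpace E] {𝒢 m : MeasurableSpace Ω} (h𝒢 : 𝒢 ≤ m)
    {P : Measure Ω} [IsFiniteMeasure P] {𝓗 : Set (Ω → E)} (h : IsSelectionStable 𝒢 P 𝓗)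
    (hne : 𝓗.Nonempty) : ∃ H ∈ 𝓗, ∀ K ∈ 𝓗, ∀ᵐ ω ∂P, ‖H ω‖ ≤ ‖K ω‖ := by
  set J : (Ω → E) → ℝ := fun H => ∫ ω, Real.arctan ‖H ω‖ ∂P with hJ
  have hint : ∀ H ∈ 𝓗, Integrable (fun ω => Real.arctan ‖H ω‖) P := fun H hH =>
    integrable_arctan ((h.measurable H hH).mono h𝒢).norm.aestronglyMeasurable
  have hbdd : BddBelow (J '' 𝓗) := by
    refine ⟨0, ?_⟩
    rintro _ ⟨H, -, rfl⟩
    exact integral_nonneg fun ω => Real.arctan_nonneg.2 (norm_nonneg _)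
  obtain ⟨a, -, ha, ha𝓗⟩ := exists_seq_tendsto_sInf (hne.image J) hbdd
  choose u hu hua using ha𝓗
  set c := sInf (J '' 𝓗) with hc
  have hcle : ∀ H ∈ 𝓗, c ≤ J H := fun H hH => csInf_le hbdd ⟨H, hH, rfl⟩
  -- Running selection along a minimising sequence, so that the norms decrease pointwise.
  let v : ℕ → Ω → E := fun n => Nat.rec (u 0)
    (fun n w ω => if ‖u (n + 1) ω‖ < ‖w ω‖ then u (n + 1) ω else w ω) n
  have hv : ∀ n, v n ∈ 𝓗 := fun n => by
    induction n with
    | zero => exact hu 0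
    | succ n ih => exact h.select _ (hu (n + 1)) _ ih
  have hvn : ∀ n ω, ‖v (n + 1) ω‖ = min ‖u (n + 1) ω‖ ‖v n ω‖ := fun n ω => norm_select _ _
  have hvu : ∀ n ω, ‖v n ω‖ ≤ ‖u n ω‖ := fun n ω => by
    cases n with
    | zero => exact le_rfl
    | succ n => exact (hvn n ω).le.trans (min_le_left _ _)
  have hanti : ∀ ω, Antitone fun n => ‖v n ω‖ := fun ω =>
    antitone_nat_of_succ_le fun n => (hvn n ω).le.trans (min_le_right _ _)
  have hbelow : ∀ ω, BddBelow (Set.range fun n => ‖v n ω‖) := fun ω =>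
    ⟨0, by rintro _ ⟨n, rfl⟩; exact norm_nonneg _⟩
  set r : Ω → ℝ := fun ω => ⨅ n, ‖v n ω‖ with hr
  have hlim : ∀ ω, Tendsto (fun n => ‖v n ω‖) atTop (𝓝 (r ω)) := fun ω =>
    tendsto_atTop_ciInf (hanti ω) (hbelow ω)
  have hr0 : ∀ ω, 0 ≤ r ω := fun ω => le_ciInf fun n => norm_nonneg _
  have hJv : Tendsto (fun n => J (v n)) atTop (𝓝 c) := by
    refine tendsto_of_tendsto_of_tendsto_of_le_of_le tendsto_const_nhds ha
      (fun n => hcle _ (hv n)) fun n => ?_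
    change J (v n) ≤ a n
    rw [← hua n]
    exact integral_mono (hint _ (hv n)) (hint _ (hu n)) fun ω =>
      Real.arctan_strictMono.monotone (hvu n ω)
  have hdom : ∀ (F : ℕ → Ω → ℝ) (G : Ω → ℝ), (∀ n, AEStronglyMeasurable (F n) P) →
      (∀ ω, Tendsto (fun n => F n ω) atTop (𝓝 (G ω))) →
      Tendsto (fun n => ∫ ω, Real.arctan (F n ω) ∂P) atTop (𝓝 (∫ ω, Real.arctan (G ω) ∂P)) := by
    intro F G hF hFG
    refine tendsto_integral_of_dominated_convergence (fun _ => Real.pi / 2)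
      (fun n => Real.continuous_arctan.comp_aestronglyMeasurable (hF n)) (integrable_const _)
      (fun n => ae_of_all _ fun ω => abs_le.2 ⟨(Real.neg_pi_div_two_lt_arctan _).le,
        (Real.arctan_lt_pi_div_two _).le⟩)
      (ae_of_all _ fun ω => (Real.continuous_arctan.tendsto _).comp (hFG ω))
  have hvm : ∀ n, AEStronglyMeasurable (fun ω => ‖v n ω‖) P := fun n =>
    ((h.measurable _ (hv n)).mono h𝒢).norm.aestronglyMeasurable
  have hrm : AEStronglyMeasurable r P := aestronglyMeasurable_of_tendsto_ae atTop hvm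
    (ae_of_all _ hlim)
  have hrc : ∫ ω, Real.arctan (r ω) ∂P = c := tendsto_nhds_unique (hdom _ _ hvm hlim) hJv
  -- Selecting between `K` and `v n` cannot push the functional below `c`; in the limit `min ‖K‖ r`
  -- and `r` have the same integral, hence agree a.s.
  have hmin : ∀ K ∈ 𝓗, ∀ᵐ ω ∂P, r ω ≤ ‖K ω‖ := by
    intro K hK
    have hKm : AEStronglyMeasurable (fun ω => ‖K ω‖) P :=
      ((h.measurable _ hK).mono h𝒢).norm.aestronglyMeasurable
    have h1 := hdom (fun n ω => min ‖K ω‖ ‖v n ω‖) (fun ω => min ‖K ω‖ (r ω))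
      (fun n => hKm.inf (hvm n)) (fun ω => tendsto_const_nhds.min (hlim ω))
    have h2 : c ≤ ∫ ω, Real.arctan (min ‖K ω‖ (r ω)) ∂P := by
      refine ge_of_tendsto' h1 fun n => ?_
      refine (hcle _ (h.select K hK _ (hv n))).trans_eq ?_
      simp only [hJ, norm_select]
    have i1 : Integrable (fun ω => Real.arctan (min ‖K ω‖ (r ω))) P :=
      integrable_arctan (hKm.inf hrm)
    have i2 := integrable_arctan hrm
    have h3 : (fun ω => Real.arctan (min ‖K ω‖ (r ω))) ≤ᵐ[P] fun ω => Real.arctan (r ω) :=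
      ae_of_all _ fun ω => Real.arctan_strictMono.monotone (min_le_right _ _)
    have h4 := (integral_eq_iff_of_ae_le i1 i2 h3).1
      (le_antisymm (integral_mono_ae i1 i2 h3) (hrc.trans_le h2))
    filter_upwards [h4] with ω hω
    exact min_eq_right_iff.1 (Real.arctan_injective hω)
  have hconv : ∀ᵐ ω ∂P, ∃ y, Tendsto (fun n => v n ω) atTop (𝓝 y) := by
    have h1 : ∀ᵐ ω ∂P, ∀ n k, r ω ≤ ‖(2⁻¹ : ℝ) • (v n ω + v k ω)‖ :=
      ae_all_iff.2 fun n => ae_all_iff.2 fun k => hmin _ (h.midpoint _ (hv n) _ (hv k))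
    filter_upwards [h1] with ω hω
    exact exists_tendsto_of_le_norm_midpoint (fun _ => hr0 ω) tendsto_const_nhds (hlim ω)
      fun n k _ => hω n k
  set L : Ω → E := fun ω => limUnder atTop fun n => v n ω with hL
  have hLlim : ∀ᵐ ω ∂P, Tendsto (fun n => v n ω) atTop (𝓝 (L ω)) := by
    filter_upwards [hconv] with ω hω
    exact tendsto_nhds_limUnder hω
  refine ⟨L, h.closed v L hv (@StronglyMeasurable.limUnder ℕ Ω E 𝒢 _ _ _ _ _ _ _ fun n => h.measurable _ (hv n)) hLlim,
    fun K hK => ?_⟩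
  filter_upwards [hLlim, hmin K hK] with ω h1 h2
  rwa [tendsto_nhds_unique h1.norm (hlim ω)]

/-- Strict convexity: where two minimisers differ, their midpoint would be shorter. -/
theorem IsSelectionStable.ae_eq_of_norm_eq {Ω E : Type*} [NormedAddCommGroup E]
    [InnerProductSpace ℝ E] {𝒢 m : MeasurableSpace Ω}
    {P : Measure Ω} {𝓗 : Set (Ω → E)} (h : IsSelectionStable 𝒢 P 𝓗) {H K : Ω → E}
    (hH : H ∈ 𝓗) (hmin : ∀ L ∈ 𝓗, ∀ᵐ ω ∂P, ‖H ω‖ ≤ ‖L ω‖) (hK : K ∈ 𝓗)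
    (hHK : ∀ᵐ ω ∂P, ‖K ω‖ = ‖H ω‖) : K =ᵐ[P] H := by
  filter_upwards [hmin _ (h.midpoint K hK H hH), hHK] with ω h1 h2
  have h3 := norm_sub_sq_le_of_le_norm_midpoint (norm_nonneg _) h1
  rw [h2] at h3
  have h4 : ‖K ω - H ω‖ ^ 2 = 0 := le_antisymm (by linarith) (by positivity)
  exact sub_eq_zero.1 (norm_eq_zero.1 (pow_eq_zero_iff two_ne_zero |>.1 h4))

/-! ### Measurable subsequences and measurability of selections -/

/-- Every bounded sequence of random vectors has a random subsequence which converges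
everywhere. -/
theorem exists_random_subsequence {Ω : Type*} {d : ℕ} [MeasurableSpace Ω]
    (G : ℕ → Ω → EuclideanSpace ℝ (Fin d)) (hG : ∀ n, StronglyMeasurable (G n))
    (hb : ∀ n ω, ‖G n ω‖ ≤ 1) :
    ∃ σ : ℕ → Ω → ℕ, (∀ k, Measurable (σ k)) ∧ (∀ k ω, k ≤ σ k ω) ∧
      ∃ L : Ω → EuclideanSpace ℝ (Fin d), StronglyMeasurable L ∧
        ∀ ω, Tendsto (fun k => G (σ k ω) ω) atTop (𝓝 (L ω)) := by
  classical
  have hcomp : ∀ σ : Ω → ℕ, Measurable σ → Measurable fun ω => G (σ ω) ω := fun σ hσ =>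
    (measurable_from_prod_countable_left (f := fun p : Ω × ℕ => G p.2 p.1)
      fun n => (hG n).measurable).comp (measurable_id.prodMk hσ)
  -- Thin out one coordinate at a time; coordinates already convergent stay so, because the new
  -- indices tend to infinity.
  have key : ∀ s : Finset (Fin d), ∃ σ : ℕ → Ω → ℕ, (∀ k, Measurable (σ k)) ∧
      (∀ k ω, k ≤ σ k ω) ∧ ∀ i ∈ s, ∀ ω, ∃ l, Tendsto (fun k => G (σ k ω) ω i) atTop (𝓝 l) := by
    intro s
    induction s using Finset.induction_on with
    | empty => exact ⟨fun k _ => k, fun k => measurable_const, fun k ω => le_rfl, by simp⟩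
    | insert i s _ ih =>
      obtain ⟨σ, hσm, hσ, hσs⟩ := ih
      set Y : ℕ → Ω → ℝ := fun n ω => G (σ n ω) ω i with hY
      have hYm : ∀ n, Measurable (Y n) := fun n => by
        exact (EuclideanSpace.proj i : EuclideanSpace ℝ (Fin d) →L[ℝ] ℝ).continuous.measurable.comp
          (hcomp (σ n) (hσm n))
      have hYb : ∀ n ω, |Y n ω| ≤ 1 := fun n ω => (PiLp.norm_apply_le _ i).trans (hb _ ω)
      set L : Ω → ℝ := fun ω => limsup (fun n => Y n ω) atTop with hLdef
      have hLm : Measurable L := Measurable.limsup hYm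
      have hex : ∀ k ω, ∃ n, k ≤ n ∧ |Y n ω - L ω| < 1 / ((k : ℝ) + 1) := by
        intro k ω
        have hpos : (0 : ℝ) < 1 / ((k : ℝ) + 1) := Nat.one_div_pos_of_nat
        have hbu : IsBoundedUnder (· ≤ ·) atTop fun n => Y n ω :=
          isBoundedUnder_of ⟨1, fun n => (abs_le.1 (hYb n ω)).2⟩
        have hbl : IsBoundedUnder (· ≥ ·) atTop fun n => Y n ω :=
          isBoundedUnder_of ⟨-1, fun n => (abs_le.1 (hYb n ω)).1⟩
        have e1 : ∃ᶠ n in atTop, L ω - 1 / ((k : ℝ) + 1) < Y n ω :=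
          frequently_lt_of_lt_limsup hbl.isCoboundedUnder_flip (sub_lt_self _ hpos)
        have e2 : ∀ᶠ n in atTop, Y n ω < L ω + 1 / ((k : ℝ) + 1) :=
          eventually_lt_of_limsup_lt (lt_add_of_pos_right _ hpos) hbu
        obtain ⟨n, ⟨h1, h2⟩, h3⟩ := ((e1.and_eventually e2).and_eventually
          (eventually_ge_atTop k)).exists
        exact ⟨n, h3, abs_lt.2 ⟨by linarith, by linarith⟩⟩
      -- The first admissible index near the limsup; taking the first one keeps the choice
      -- measurable.
      let τ : ℕ → Ω → ℕ := fun k ω => Nat.find (hex k ω)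
      have hτ : ∀ k ω, k ≤ τ k ω ∧ |Y (τ k ω) ω - L ω| < 1 / ((k : ℝ) + 1) := fun k ω =>
        Nat.find_spec (hex k ω)
      have hτm : ∀ k, Measurable (τ k) := fun k => measurable_find _ fun n => by
        by_cases hkn : k ≤ n
        · simp only [hkn, true_and]
          exact measurableSet_lt (continuous_abs.measurable.comp ((hYm n).sub hLm))
            measurable_const
        · simp [hkn]
      have hτt : ∀ ω, Tendsto (fun k => τ k ω) atTop atTop := fun ω =>
        tendsto_atTop_mono (fun k => (hτ k ω).1) tendsto_id
      refine ⟨fun k ω => σ (τ k ω) ω, fun k => ?_, fun k ω => (hτ k ω).1.trans (hσ _ ω), ?_⟩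
      · exact (measurable_from_prod_countable_left (f := fun p : Ω × ℕ => σ p.2 p.1)
          hσm).comp (measurable_id.prodMk (hτm k))
      · intro j hj ω
        rcases Finset.mem_insert.1 hj with rfl | hj
        · refine ⟨L ω, ?_⟩
          rw [tendsto_iff_dist_tendsto_zero]
          exact squeeze_zero (fun _ => dist_nonneg) (fun k => (hτ k ω).2.le)
            tendsto_one_div_add_atTop_nhds_zero_nat
        · obtain ⟨l, hl⟩ := hσs j hj ω
          exact ⟨l, hl.comp (hτt ω)⟩
  obtain ⟨σ, hσm, hσ, hσs⟩ := key Finset.univ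
  choose l hl using fun ω i => hσs i (Finset.mem_univ i) ω
  have hlim : ∀ ω, Tendsto (fun k => G (σ k ω) ω) atTop (𝓝 (WithLp.toLp 2 (l ω))) := fun ω =>
    ((PiLp.continuous_toLp 2 _).tendsto _).comp (tendsto_pi_nhds.2 fun i => hl ω i)
  exact ⟨σ, hσm, hσ, fun ω => WithLp.toLp 2 (l ω), stronglyMeasurable_of_tendsto atTop
    (fun k => (hcomp (σ k) (hσm k)).stronglyMeasurable) (tendsto_pi_nhds.2 hlim), hlim⟩

theorem stronglyMeasurable_select {Ω E : Type*} {_ : MeasurableSpace Ω} [NormedAddCommGroup E]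
    {H K : Ω → E} (hH : StronglyMeasurable H) (hK : StronglyMeasurable K) :
    MeasurableSet {ω | ‖H ω‖ < ‖K ω‖} ∧
      StronglyMeasurable fun ω => if ‖H ω‖ < ‖K ω‖ then H ω else K ω :=
  have hA := hH.norm.measurableSet_lt hK.norm
  ⟨hA, StronglyMeasurable.ite hA hH hK⟩

theorem measurableSet_bddAbove_range_norm {Ω E : Type*} {_ : MeasurableSpace Ω}
    [NormedAddCommGroup E] {H : ℕ → Ω → E} (hH : ∀ n, StronglyMeasurable (H n)) :
    MeasurableSet {ω | BddAbove (Set.range fun n => ‖H n ω‖)} :=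
  measurableSet_bddAbove_range fun n => (hH n).norm.measurable

theorem stronglyMeasurable_inv_norm {Ω E : Type*} {_ : MeasurableSpace Ω}
    [NormedAddCommGroup E] {H : Ω → E} (hH : StronglyMeasurable H) :
    StronglyMeasurable fun ω => ‖H ω‖⁻¹ :=
  hH.norm.measurable.inv.stronglyMeasurable

theorem stronglyMeasurable_max_zero {Ω : Type*} {_ : MeasurableSpace Ω} {a : Ω → ℝ}
    (ha : StronglyMeasurable a) : StronglyMeasurable fun ω => max (a ω) 0 :=
  ha.sup stronglyMeasurable_const

/-! ### One-period hedging -/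

/-- Convex cones of families of random payoffs which are stable under multiplication by nonnegative
`𝒢`-measurable functions, solid, and closed under almost sure limits, where almost sure relations
are required for the indices in `F` only. -/
structure IsClaimCone {Ω ι : Type*} (𝒢 : MeasurableSpace Ω) {m : MeasurableSpace Ω} (P : Measure Ω)
    (F : Set ι) (𝓒 : Set (ι → Ω → ℝ)) : Prop where
  zero_mem : (fun _ _ => 0) ∈ 𝓒
  add_mem : ∀ f ∈ 𝓒, ∀ g ∈ 𝓒, (fun θ ω => f θ ω + g θ ω) ∈ 𝓒
  mul_mem : ∀ f ∈ 𝓒, ∀ a : Ω → ℝ, StronglyMeasurable[𝒢] a → (∀ ω, 0 ≤ a ω) →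
    (fun θ ω => a ω * f θ ω) ∈ 𝓒
  mono : ∀ f ∈ 𝓒, ∀ g : ι → Ω → ℝ, (∀ θ ∈ F, ∀ᵐ ω ∂P, g θ ω ≤ f θ ω) → g ∈ 𝓒
  closed : ∀ (f : ℕ → ι → Ω → ℝ) (g : ι → Ω → ℝ), (∀ n, f n ∈ 𝓒) →
    (∀ θ ∈ F, ∀ᵐ ω ∂P, Tendsto (fun n => f n θ ω) atTop (𝓝 (g θ ω))) → g ∈ 𝓒

/-- The `𝒢`-measurable positions in the increments `X` which reduce `f` to an element of `𝓒`. -/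
def hedges {Ω ι E : Type*} [NormedAddCommGroup E] [InnerProductSpace ℝ E] (𝒢 : MeasurableSpace Ω)
    (𝓒 : Set (ι → Ω → ℝ)) (X : ι → Ω → E) (f : ι → Ω → ℝ) : Set (Ω → E) :=
  {H | StronglyMeasurable[𝒢] H ∧ (fun θ ω => f θ ω - inner ℝ (H ω) (X θ ω)) ∈ 𝓒}

namespace IsClaimCone

variable {Ω ι : Type*} {𝒢 m : MeasurableSpace Ω} {P : Measure Ω} {F : Set ι}
  {𝓒 : Set (ι → Ω → ℝ)}

theorem congr (h : IsClaimCone 𝒢 P F 𝓒) {f g : ι → Ω → ℝ} (hf : f ∈ 𝓒)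
    (hfg : ∀ θ ω, g θ ω = f θ ω) : g ∈ 𝓒 :=
  h.mono f hf g fun θ _ => ae_of_all _ fun ω => (hfg θ ω).le

theorem combine_mem (h : IsClaimCone 𝒢 P F 𝓒) {f g : ι → Ω → ℝ} (hf : f ∈ 𝓒) (hg : g ∈ 𝓒)
    {a : Ω → ℝ} (ha : StronglyMeasurable[𝒢] a) (h0 : ∀ ω, 0 ≤ a ω) (h1 : ∀ ω, a ω ≤ 1) :
    (fun θ ω => a ω * f θ ω + (1 - a ω) * g θ ω) ∈ 𝓒 :=
  h.add_mem _ (h.mul_mem f hf a ha h0) _ (h.mul_mem g hg (fun ω => 1 - a ω)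
    (stronglyMeasurable_const.sub ha) fun ω => sub_nonneg.2 (h1 ω))

open Classical in
theorem ite_mem (h : IsClaimCone 𝒢 P F 𝓒) {f g : ι → Ω → ℝ} (hf : f ∈ 𝓒) (hg : g ∈ 𝓒)
    {A : Set Ω} (hA : MeasurableSet[𝒢] A) :
    (fun θ ω => if ω ∈ A then f θ ω else g θ ω) ∈ 𝓒 := by
  refine h.congr (h.combine_mem hf hg (a := A.indicator fun _ => 1)
    (stronglyMeasurable_const.indicator hA) (fun ω => ?_) (fun ω => ?_)) fun θ ω => ?_
  · exact Set.indicator_nonneg (fun _ _ => zero_le_one) _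
  · exact Set.indicator_le_self' (fun _ _ => zero_le_one) _
  · by_cases hω : ω ∈ A <;> simp [hω]

/-- Cut off at `σ < N`, the family is a finite gluing along measurable sets; then let `N → ∞`. -/
theorem random_index_mem (h : IsClaimCone 𝒢 P F 𝓒) {f : ℕ → ι → Ω → ℝ} (hf : ∀ n, f n ∈ 𝓒)
    {σ : Ω → ℕ} (hσ : Measurable[𝒢] σ) : (fun θ ω => f (σ ω) θ ω) ∈ 𝓒 := by
  classical
  have key : ∀ N, (fun θ ω => if σ ω < N then f (σ ω) θ ω else 0) ∈ 𝓒 := by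
    intro N
    induction N with
    | zero => simpa using h.zero_mem
    | succ N ih =>
      refine h.congr (h.ite_mem (hf N) ih (A := σ ⁻¹' {N})
        (hσ (MeasurableSet.singleton N))) fun θ ω => ?_
      by_cases h1 : σ ω = N
      · simp [h1]
      · have h2 : σ ω < N + 1 ↔ σ ω < N := by omega
        simp [h1, h2]
  refine h.closed _ _ key fun θ _ => ae_of_all _ fun ω => tendsto_const_nhds.congr' ?_
  filter_upwards [eventually_gt_atTop (σ ω)] with N hN
  simp [hN]

theorem isSelectionStable_hedges {E : Type*} [NormedAddCommGroup E] [InnerProductSpace ℝ E]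
    (h : IsClaimCone 𝒢 P F 𝓒) (X : ι → Ω → E) (f : ι → Ω → ℝ) :
    IsSelectionStable 𝒢 P (hedges 𝒢 𝓒 X f) where
  measurable H hH := hH.1
  midpoint H hH K hK := by
    refine ⟨(hH.1.add hK.1).const_smul _, h.congr (h.combine_mem hH.2 hK.2 (a := fun _ => 2⁻¹)
      stronglyMeasurable_const (fun _ => by norm_num) (fun _ => by norm_num)) fun θ ω => ?_⟩
    simp only [inner_smul_left, inner_add_left, RCLike.conj_to_real]
    ring
  select H hH K hK := by
    classical
    obtain ⟨hA, hm⟩ := stronglyMeasurable_select hH.1 hK.1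
    refine ⟨hm, h.congr (h.ite_mem hH.2 hK.2 hA) fun θ ω => ?_⟩
    by_cases h1 : ‖H ω‖ < ‖K ω‖ <;> simp [h1]
  closed H K hH hK hlim := by
    refine ⟨hK, h.closed _ _ (fun n => (hH n).2) fun θ _ => ?_⟩
    filter_upwards [hlim] with ω hω
    exact tendsto_const_nhds.sub (hω.inner tendsto_const_nhds)

theorem mul_mem_of_neg_mem (h : IsClaimCone 𝒢 P F 𝓒) {f : ι → Ω → ℝ} (hf : f ∈ 𝓒) (hf' : (fun θ ω => -f θ ω) ∈ 𝓒)
    {a : Ω → ℝ} (ha : StronglyMeasurable[𝒢] a) : (fun θ ω => a ω * f θ ω) ∈ 𝓒 := by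
  refine h.congr (h.add_mem _ (h.mul_mem _ hf (fun ω => max (a ω) 0)
    (stronglyMeasurable_max_zero ha) fun ω => le_max_right _ _) _
    (h.mul_mem _ hf' (fun ω => max (-a ω) 0) (stronglyMeasurable_max_zero ha.neg)
      fun ω => le_max_right _ _)) fun θ ω => ?_
  rcases le_total 0 (a ω) with h1 | h1
  · simp [h1]
  · simp [h1]

/-- Hedges of minimal norm of an increasing sequence of claims stay bounded almost surely if
the positions whose loss is hedgeable have a hedgeable gain. -/
theorem ae_bddAbove_norm_of_minimal {d : ℕ} (h : IsClaimCone 𝒢 P F 𝓒)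
    (X : ι → Ω → EuclideanSpace ℝ (Fin d))
    (hrev : ∀ H : Ω → EuclideanSpace ℝ (Fin d), StronglyMeasurable[𝒢] H →
      (fun θ ω => -inner ℝ (H ω) (X θ ω)) ∈ 𝓒 → (fun θ ω => inner ℝ (H ω) (X θ ω)) ∈ 𝓒)
    {f : ℕ → ι → Ω → ℝ} {g : ι → Ω → ℝ}
    (hfg : ∀ θ ∈ F, ∀ᵐ ω ∂P, Tendsto (fun n => f n θ ω) atTop (𝓝 (g θ ω)))
    {H : ℕ → Ω → EuclideanSpace ℝ (Fin d)} (hH : ∀ n, H n ∈ hedges 𝒢 𝓒 X (f n))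
    (hmin : ∀ n, ∀ K ∈ hedges 𝒢 𝓒 X (f n), ∀ᵐ ω ∂P, ‖H n ω‖ ≤ ‖K ω‖)
    (hmono : ∀ᵐ ω ∂P, Monotone fun n => ‖H n ω‖) :
    ∀ᵐ ω ∂P, BddAbove (Set.range fun n => ‖H n ω‖) := by
  classical
  set A : Set Ω := {ω | BddAbove (Set.range fun n => ‖H n ω‖)}ᶜ with hA
  have hAm : MeasurableSet[𝒢] A :=
    (measurableSet_bddAbove_range_norm fun n => (hH n).1).compl
  -- Where `H n` vanishes the inverse is `0`; this is harmless, since on `A` the norms a.s. tend to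
  -- infinity.
  set b : ℕ → Ω → ℝ := fun n => A.indicator fun ω => ‖H n ω‖⁻¹ with hb
  have hbm : ∀ n, StronglyMeasurable[𝒢] (b n) := fun n =>
    (stronglyMeasurable_inv_norm (hH n).1).indicator hAm
  have hb0 : ∀ n ω, 0 ≤ b n ω := fun n ω =>
    Set.indicator_nonneg (fun _ _ => inv_nonneg.2 (norm_nonneg _)) _
  set G : ℕ → Ω → EuclideanSpace ℝ (Fin d) := fun n ω => b n ω • H n ω with hG
  have hGm : ∀ n, StronglyMeasurable[𝒢] (G n) := fun n => (hbm n).smul (hH n).1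
  have hGnorm : ∀ n ω, ‖G n ω‖ = b n ω * ‖H n ω‖ := fun n ω => by
    rw [hG, norm_smul, Real.norm_of_nonneg (hb0 n ω)]
  have hGb : ∀ n ω, ‖G n ω‖ ≤ 1 := fun n ω => by
    rw [hGnorm]
    by_cases hω : ω ∈ A
    · simpa [hb, hω] using inv_mul_le_one (a := ‖H n ω‖)
    · simp [hb, hω]
  obtain ⟨σ, hσm, hσ, L, hLm, hL⟩ := @exists_random_subsequence Ω d 𝒢 G hGm hGb
  have hσt : ∀ ω, Tendsto (fun k => σ k ω) atTop atTop := fun ω =>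
    tendsto_atTop_mono (fun k => hσ k ω) tendsto_id
  have hunb : ∀ᵐ ω ∂P, ω ∈ A → Tendsto (fun n => ‖H n ω‖) atTop atTop := by
    filter_upwards [hmono] with ω hω hωA
    exact (tendsto_atTop_atTop_of_monotone' hω hωA)
  -- The factors `b n` tend to `0`, so the claims disappear in the limit and only the normalised
  -- position remains.
  have hneg : (fun θ ω => -inner ℝ (L ω) (X θ ω)) ∈ 𝓒 := by
    refine h.closed (fun k θ ω => b (σ k ω) ω *
      (f (σ k ω) θ ω - inner ℝ (H (σ k ω) ω) (X θ ω))) _ (fun k => h.random_index_mem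
      (f := fun n θ ω => b n ω * (f n θ ω - inner ℝ (H n ω) (X θ ω)))
      (fun n => h.mul_mem _ (hH n).2 _ (hbm n) (hb0 n)) (hσm k)) fun θ hθ => ?_
    filter_upwards [hfg θ hθ, hunb] with ω h1 h2
    have h3 : Tendsto (fun n => b n ω) atTop (𝓝 0) := by
      by_cases hω : ω ∈ A
      · simpa [hb, hω] using! (h2 hω).inv_tendsto_atTop
      · simp [hb, hω]
    have h4 : Tendsto (fun k => b (σ k ω) ω * f (σ k ω) θ ω) atTop (𝓝 0) := by
      simpa using! (h3.mul h1).comp (hσt ω)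
    have h5 := h4.sub ((hL ω).inner (tendsto_const_nhds (x := X θ ω)))
    rw [zero_sub] at h5
    refine h5.congr fun k => ?_
    rw [hG, inner_smul_left, RCLike.conj_to_real]
    ring
  have hpos := hrev L hLm hneg
  have hLb : ∀ ω, ‖L ω‖ ≤ 1 := fun ω => le_of_tendsto' (hL ω).norm fun k => hGb _ _
  have horth : ∀ᵐ ω ∂P, ∀ n, inner ℝ (H n ω) (L ω) = 0 := by
    refine ae_all_iff.2 fun n => ?_
    have hcm : StronglyMeasurable[𝒢] fun ω => inner ℝ (H n ω) (L ω) := (hH n).1.inner hLm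
    -- Since `L` is reversible, any `𝒢`-measurable multiple of it may be removed from a hedge. With
    -- `c = ⟨H n, L⟩` and `‖L‖ ≤ 1`, one gets `‖H n - c L‖² ≤ ‖H n‖² - c²`, so minimality forces `c
    -- = 0`.
    have hmem : (fun ω => H n ω - inner ℝ (H n ω) (L ω) • L ω) ∈ hedges 𝒢 𝓒 X (f n) := by
      refine ⟨(hH n).1.sub (hcm.smul hLm), h.congr (h.add_mem _ (hH n).2 _
        (h.mul_mem_of_neg_mem hpos hneg hcm)) fun θ ω => ?_⟩
      rw [inner_sub_left, inner_smul_left, RCLike.conj_to_real]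
      ring
    filter_upwards [hmin n _ hmem] with ω hω
    have h1 := pow_le_pow_left₀ (norm_nonneg _) hω 2
    rw [norm_sub_sq_real, inner_smul_right, norm_smul, mul_pow, Real.norm_eq_abs, sq_abs] at h1
    have h2 : ‖L ω‖ ^ 2 ≤ 1 := pow_le_one₀ (norm_nonneg _) (hLb ω)
    have h3 : inner ℝ (H n ω) (L ω) ^ 2 * ‖L ω‖ ^ 2 ≤ inner ℝ (H n ω) (L ω) ^ 2 :=
      mul_le_of_le_one_right (sq_nonneg _) h2
    exact pow_eq_zero_iff two_ne_zero |>.1 (le_antisymm (by nlinarith) (sq_nonneg _))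
  filter_upwards [horth, hunb] with ω h1 h2
  by_contra hω
  have hωA : ω ∈ A := hω
  -- `L` is a limit of multiples of vectors orthogonal to it, hence zero, whereas on `A` it is a
  -- limit of vectors that are eventually of norm one.
  have h3 : inner ℝ (L ω) (L ω) = (0 : ℝ) := by
    refine tendsto_nhds_unique ((hL ω).inner (tendsto_const_nhds (x := L ω))) ?_
    refine tendsto_const_nhds.congr fun k => ?_
    rw [hG, inner_smul_left, h1, mul_zero]
  have h4 : Tendsto (fun k => ‖G (σ k ω) ω‖) atTop (𝓝 1) := by
    refine tendsto_const_nhds.congr' ?_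
    filter_upwards [((h2 hωA).comp (hσt ω)).eventually_gt_atTop 0] with k hk
    have hk' : ‖H (σ k ω) ω‖ ≠ 0 := ne_of_gt hk
    rw [hGnorm, hb]
    simp [hωA, inv_mul_cancel₀ hk']
  have h5 := tendsto_nhds_unique (hL ω).norm h4
  rw [inner_self_eq_zero.1 h3, norm_zero] at h5
  exact zero_ne_one h5

theorem nonempty_hedges_of_tendsto {d : ℕ} [IsFiniteMeasure P] (h𝒢 : 𝒢 ≤ m)
    (h : IsClaimCone 𝒢 P F 𝓒) (X : ι → Ω → EuclideanSpace ℝ (Fin d))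
    (hrev : ∀ H : Ω → EuclideanSpace ℝ (Fin d), StronglyMeasurable[𝒢] H →
      (fun θ ω => -inner ℝ (H ω) (X θ ω)) ∈ 𝓒 → (fun θ ω => inner ℝ (H ω) (X θ ω)) ∈ 𝓒)
    {f : ℕ → ι → Ω → ℝ} {g : ι → Ω → ℝ} (hf : ∀ n, (hedges 𝒢 𝓒 X (f n)).Nonempty)
    (hfg : ∀ θ ∈ F, ∀ᵐ ω ∂P, Tendsto (fun n => f n θ ω) atTop (𝓝 (g θ ω))) :
    (hedges 𝒢 𝓒 X g).Nonempty := by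
  -- Tail infima have the same limit but increase in `n`, so their hedge sets are nested; being
  -- smaller claims, they remain hedgeable.
  set u : ℕ → ι → Ω → ℝ := fun n θ ω => ⨅ k, f (n + k) θ ω with hu
  have hbelow : ∀ θ ∈ F, ∀ᵐ ω ∂P, ∀ n, BddBelow (Set.range fun k => f (n + k) θ ω) := by
    intro θ hθ
    filter_upwards [hfg θ hθ] with ω hω n
    exact (hω.bddBelow_range).mono (by rintro _ ⟨k, rfl⟩; exact ⟨n + k, rfl⟩)
  have hanti : ∀ n k, n ≤ k → hedges 𝒢 𝓒 X (u k) ⊆ hedges 𝒢 𝓒 X (u n) := by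
    intro n k hnk H hH
    refine ⟨hH.1, h.mono _ hH.2 _ fun θ hθ => ?_⟩
    filter_upwards [hbelow θ hθ] with ω hω
    refine sub_le_sub_right (le_ciInf fun j => ?_) _
    obtain ⟨i, rfl⟩ := Nat.exists_eq_add_of_le hnk
    simpa [add_assoc] using ciInf_le (hω n) (i + j)
  have hune : ∀ n, (hedges 𝒢 𝓒 X (u n)).Nonempty := by
    intro n
    obtain ⟨H, hH⟩ := hf n
    refine ⟨H, hH.1, h.mono _ hH.2 _ fun θ hθ => ?_⟩
    filter_upwards [hbelow θ hθ] with ω hω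
    exact sub_le_sub_right (by simpa using ciInf_le (hω n) 0) _
  have hulim : ∀ θ ∈ F, ∀ᵐ ω ∂P, Tendsto (fun n => u n θ ω) atTop (𝓝 (g θ ω)) := by
    intro θ hθ
    filter_upwards [hfg θ hθ, hbelow θ hθ] with ω h1 h2
    rw [Metric.tendsto_atTop] at h1 ⊢
    intro ε hε
    obtain ⟨N, hN⟩ := h1 (ε / 2) (half_pos hε)
    refine ⟨N, fun n hn => ?_⟩
    have h3 : g θ ω - ε / 2 ≤ u n θ ω := le_ciInf fun k => by
      have := (abs_lt.1 (hN (n + k) (by omega))).1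
      linarith
    have h4 : u n θ ω ≤ f n θ ω := by simpa using ciInf_le (h2 n) 0
    have h5 := (abs_lt.1 (hN n hn)).2
    exact abs_lt.2 ⟨by linarith, by linarith⟩
  choose H hH hmin using fun n =>
    (h.isSelectionStable_hedges X (u n)).exists_forall_norm_le h𝒢 (hune n)
  have hmono : ∀ᵐ ω ∂P, Monotone fun n => ‖H n ω‖ := by
    have h1 : ∀ᵐ ω ∂P, ∀ n, ‖H n ω‖ ≤ ‖H (n + 1) ω‖ :=
      ae_all_iff.2 fun n => hmin n _ (hanti n (n + 1) n.le_succ (hH _))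
    filter_upwards [h1] with ω hω
    exact monotone_nat_of_le_succ hω
  have hbdd := h.ae_bddAbove_norm_of_minimal X hrev hulim hH hmin hmono
  have hmid : ∀ᵐ ω ∂P, ∀ n k, n ≤ k → ‖H n ω‖ ≤ ‖(2⁻¹ : ℝ) • (H n ω + H k ω)‖ := by
    refine ae_all_iff.2 fun n => ae_all_iff.2 fun k => ?_
    by_cases hnk : n ≤ k
    · filter_upwards [hmin n _ ((h.isSelectionStable_hedges X (u n)).midpoint _ (hH n) _
        (hanti n k hnk (hH k)))] with ω hω _ using hω
    · exact ae_of_all _ fun ω h1 => absurd h1 hnk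
  have hlim : ∀ᵐ ω ∂P, Tendsto (fun n => H n ω) atTop (𝓝 (limUnder atTop fun n => H n ω)) := by
    filter_upwards [hmono, hbdd, hmid] with ω h1 h2 h3
    have h4 := tendsto_atTop_ciSup h1 h2
    exact tendsto_nhds_limUnder
      (exists_tendsto_of_le_norm_midpoint (fun n => norm_nonneg _) h4 h4 h3)
  refine ⟨fun ω => limUnder atTop fun n => H n ω,
    @StronglyMeasurable.limUnder ℕ Ω _ 𝒢 _ _ _ _ _ _ _ fun n => (hH n).1,
    h.closed _ _ (fun n => (hH n).2) fun θ hθ => ?_⟩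
  filter_upwards [hulim θ hθ, hlim] with ω h1 h2
  exact h1.sub (h2.inner tendsto_const_nhds)

end IsClaimCone

/-! ### From countable sets of models to all models -/

/-- A family of claim cones indexed by sets of models, antitone in the models: a claim which can be
hedged in one step for every countable set of models containing `D` has a common hedge. -/
theorem exists_common_hedge {Ω ι E : Type*} [NormedAddCommGroup E] [InnerProductSpace ℝ E]
    [CompleteSpace E] {𝒢 m : MeasurableSpace Ω} (h𝒢 : 𝒢 ≤ m) {P : Measure Ω} [IsFiniteMeasure P]
    {D : Set ι} (hD : D.Countable) {𝓒 : Set ι → Set (ι → Ω → ℝ)} (hanti : Antitone 𝓒)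
    (h : ∀ F, D ⊆ F → IsClaimCone 𝒢 P F (𝓒 F)) (X : ι → Ω → E) (f : ι → Ω → ℝ)
    (hf : ∀ F : Set ι, F.Countable → D ⊆ F → (hedges 𝒢 (𝓒 F) X f).Nonempty) :
    ∃ H, ∀ F : Set ι, F.Countable → D ⊆ F → H ∈ hedges 𝒢 (𝓒 F) X f := by
  have hst : ∀ F, D ⊆ F → IsSelectionStable 𝒢 P (hedges 𝒢 (𝓒 F) X f) := fun F hF =>
    (h F hF).isSelectionStable_hedges X f
  have hsub : ∀ F F', F ⊆ F' → hedges 𝒢 (𝓒 F') X f ⊆ hedges 𝒢 (𝓒 F) X f := fun F F' hF H hH =>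
    ⟨hH.1, hanti hF hH.2⟩
  let 𝓕 : Type _ := {F : Set ι // F.Countable ∧ D ⊆ F}
  choose H hH hmin using fun F : 𝓕 =>
    (hst F.1 F.2.2).exists_forall_norm_le h𝒢 (hf F.1 F.2.1 F.2.2)
  set J : 𝓕 → ℝ := fun F => ∫ ω, Real.arctan ‖H F ω‖ ∂P with hJ
  have hint : ∀ F, Integrable (fun ω => Real.arctan ‖H F ω‖) P := fun F =>
    integrable_arctan (((hH F).1.mono h𝒢).norm.aestronglyMeasurable)
  have hle : ∀ F F' : 𝓕, F.1 ⊆ F'.1 → ∀ᵐ ω ∂P, ‖H F ω‖ ≤ ‖H F' ω‖ := fun F F' hF =>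
    hmin F _ (hsub _ _ hF (hH F'))
  have hJmono : ∀ F F' : 𝓕, F.1 ⊆ F'.1 → J F ≤ J F' := fun F F' hF => by
    refine integral_mono_ae (hint F) (hint F') ?_
    filter_upwards [hle F F' hF] with ω hω
    exact Real.arctan_strictMono.monotone hω
  have hbdd : BddAbove (Set.range J) := by
    refine ⟨∫ _, Real.pi / 2 ∂P, ?_⟩
    rintro _ ⟨F, rfl⟩
    exact integral_mono (hint F) (integrable_const _) fun ω => (Real.arctan_lt_pi_div_two _).le
  have hne : (Set.range J).Nonempty := ⟨_, ⟨D, hD, subset_rfl⟩, rfl⟩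
  obtain ⟨a, -, ha, haJ⟩ := exists_seq_tendsto_sSup hne hbdd
  choose G hG using haJ
  -- The supremum is attained at the union of a maximising sequence, since `J` increases with the
  -- set of models.
  let F₀ : 𝓕 := ⟨⋃ n, (G n).1, Set.countable_iUnion fun n => (G n).2.1,
    (G 0).2.2.trans (Set.subset_iUnion (fun n => (G n).1) 0)⟩
  have hmax : ∀ F : 𝓕, J F ≤ J F₀ := fun F => by
    refine (le_csSup hbdd ⟨F, rfl⟩).trans (le_of_tendsto' ha fun n => ?_)
    rw [← hG n]
    exact hJmono _ _ (Set.subset_iUnion (fun n => (G n).1) n)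
  refine ⟨H F₀, fun F hF hDF => ?_⟩
  let F₁ : 𝓕 := ⟨F ∪ F₀.1, hF.union F₀.2.1, hDF.trans Set.subset_union_left⟩
  have h01 : F₀.1 ⊆ F₁.1 := Set.subset_union_right
  have hnorm : ∀ᵐ ω ∂P, ‖H F₁ ω‖ = ‖H F₀ ω‖ := by
    have h1 : (fun ω => Real.arctan ‖H F₀ ω‖) ≤ᵐ[P] fun ω => Real.arctan ‖H F₁ ω‖ := by
      filter_upwards [hle F₀ F₁ h01] with ω hω
      exact Real.arctan_strictMono.monotone hω
    have h2 := (integral_eq_iff_of_ae_le (hint F₀) (hint F₁) h1).1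
      (le_antisymm (hJmono _ _ h01) (hmax F₁))
    filter_upwards [h2] with ω hω
    exact (Real.arctan_injective hω).symm
  have heq := (hst F₀.1 F₀.2.2).ae_eq_of_norm_eq (hH F₀) (hmin F₀) (hsub _ _ h01 (hH F₁)) hnorm
  -- The minimal hedge for `F ∪ F₀` works for `F` and equals that for `F₀` a.s.
  refine ⟨(hH F₀).1, (h F hDF).mono _ (hsub F F₁.1 Set.subset_union_left (hH F₁)).2 _
    fun θ _ => ?_⟩
  filter_upwards [heq] with ω hω
  rw [hω]

/-! ### Trading from a given date on -/

/-- The gain accumulated from date `t` on. -/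
noncomputable def tailGain {Ω : Type*} {T d : ℕ} (t : ℕ) (H : Fin T → Ω → EuclideanSpace ℝ (Fin d))
    (S : Fin (T + 1) → Ω → EuclideanSpace ℝ (Fin d)) (ω : Ω) : ℝ :=
  ∑ s ∈ Finset.univ.filter fun s : Fin T => t ≤ (s : ℕ),
    inner ℝ (H s ω) (S s.succ ω - S s.castSucc ω)

section tailGain

variable {Ω : Type*} {T d : ℕ} (H K : Fin T → Ω → EuclideanSpace ℝ (Fin d))
  (S : Fin (T + 1) → Ω → EuclideanSpace ℝ (Fin d)) (ω : Ω)

theorem tailGain_zero : tailGain 0 H S ω = gain H S ω := by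
  simp [tailGain, gain]

theorem tailGain_last : tailGain T H S ω = 0 := by
  refine Finset.sum_eq_zero fun s hs => ?_
  have := (Finset.mem_filter.1 hs).2
  omega

theorem tailGain_eq_add (t : Fin T) : tailGain t H S ω =
    inner ℝ (H t ω) (S t.succ ω - S t.castSucc ω) + tailGain (t + 1) H S ω := by
  have h : Finset.univ.filter (fun s : Fin T => (t : ℕ) ≤ s) =
      insert t (Finset.univ.filter fun s : Fin T => (t : ℕ) + 1 ≤ s) := by
    ext s
    simp only [Finset.mem_filter, Finset.mem_univ, true_and, Finset.mem_insert, Fin.ext_iff]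
    omega
  rw [tailGain, h, Finset.sum_insert (by simp), tailGain]

variable {H K} in
theorem tailGain_congr {t : ℕ} (h : ∀ s : Fin T, t ≤ s → H s ω = K s ω) :
    tailGain t H S ω = tailGain t K S ω :=
  Finset.sum_congr rfl fun s hs => by rw [h s (Finset.mem_filter.1 hs).2]

theorem gain_ite (t : ℕ) :
    gain (fun s ω => if t ≤ (s : ℕ) then H s ω else 0) S ω = tailGain t H S ω := by
  rw [gain, tailGain, Finset.sum_filter]
  refine Finset.sum_congr rfl fun s _ => ?_
  split_ifs <;> simp

theorem tailGain_add (t : ℕ) :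
    tailGain t (fun s ω => H s ω + K s ω) S ω = tailGain t H S ω + tailGain t K S ω := by
  simp [tailGain, inner_add_left, Finset.sum_add_distrib]

theorem tailGain_neg (t : ℕ) : tailGain t (fun s ω => -H s ω) S ω = -tailGain t H S ω := by
  simp [tailGain, inner_neg_left]

theorem tailGain_smul (t : ℕ) (a : Ω → ℝ) :
    tailGain t (fun s ω => a ω • H s ω) S ω = a ω * tailGain t H S ω := by
  simp [tailGain, inner_smul_left, Finset.mul_sum]

end tailGain

/-- The families of payoffs which can be superhedged, in all models in `F` simultaneously, by
trading from date `t` on. -/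
def superhedgeable {Ω ι : Type*} {m : MeasurableSpace Ω} {T d : ℕ} (ℱ : Filtration (Fin (T + 1)) m)
    (P : Measure Ω) (S : ι → Fin (T + 1) → Ω → EuclideanSpace ℝ (Fin d)) (t : ℕ) (F : Set ι) :
    Set (ι → Ω → ℝ) :=
  {f | ∃ H : Fin T → Ω → EuclideanSpace ℝ (Fin d), IsStrategy ℱ H ∧
    ∀ θ ∈ F, ∀ᵐ ω ∂P, f θ ω ≤ tailGain t H (S θ) ω}

/-- No robust arbitrage for the models in `F`. -/
def NRAOn {Ω ι : Type*} {m : MeasurableSpace Ω} {T d : ℕ} (ℱ : Filtration (Fin (T + 1)) m)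
    (P : Measure Ω) (S : ι → Fin (T + 1) → Ω → EuclideanSpace ℝ (Fin d)) (F : Set ι) : Prop :=
  ∀ H : Fin T → Ω → EuclideanSpace ℝ (Fin d), IsStrategy ℱ H →
    (∀ θ ∈ F, ∀ᵐ ω ∂P, 0 ≤ gain H (S θ) ω) → ∀ θ ∈ F, ∀ᵐ ω ∂P, gain H (S θ) ω = 0

section market

variable {Ω ι : Type*} {m : MeasurableSpace Ω} {T d : ℕ} {ℱ : Filtration (Fin (T + 1)) m}
  {P : Measure Ω} {S : ι → Fin (T + 1) → Ω → EuclideanSpace ℝ (Fin d)}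

theorem superhedgeable_antitone (t : ℕ) : Antitone (superhedgeable ℱ P S t) :=
  fun _ _ hF _ ⟨H, hH, h⟩ => ⟨H, hH, fun θ hθ => h θ (hF hθ)⟩

theorem IsStrategy.update {H : Fin T → Ω → EuclideanSpace ℝ (Fin d)} (hH : IsStrategy ℱ H)
    {t : Fin T} {K : Ω → EuclideanSpace ℝ (Fin d)} (hK : StronglyMeasurable[ℱ t.castSucc] K) :
    IsStrategy ℱ (Function.update H t K) := by
  intro s
  by_cases hs : s = t
  · subst hs
    rwa [Function.update_self]
  · rw [Function.update_of_ne hs]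
    exact hH s

theorem IsStrategy.ite {H : Fin T → Ω → EuclideanSpace ℝ (Fin d)} {t : ℕ}
    (hH : ∀ s : Fin T, t ≤ (s : ℕ) → StronglyMeasurable[ℱ s.castSucc] (H s)) :
    IsStrategy ℱ fun s ω => if t ≤ (s : ℕ) then H s ω else 0 := by
  intro s
  by_cases hs : t ≤ (s : ℕ)
  · simpa only [hs, if_true] using! hH s hs
  · simp only [hs, if_false]
    exact stronglyMeasurable_const

theorem tailGain_update (t : Fin T) (H : Fin T → Ω → EuclideanSpace ℝ (Fin d))
    (K : Ω → EuclideanSpace ℝ (Fin d)) (S : Fin (T + 1) → Ω → EuclideanSpace ℝ (Fin d)) (ω : Ω) :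
    tailGain t (Function.update H t K) S ω =
      inner ℝ (K ω) (S t.succ ω - S t.castSucc ω) + tailGain (t + 1) H S ω := by
  rw [tailGain_eq_add, Function.update_self]
  congr 1
  refine tailGain_congr _ _ fun s hs => ?_
  rw [Function.update_of_ne (by rintro rfl; omega)]

theorem mem_superhedgeable_iff (t : Fin T) (F : Set ι) (f : ι → Ω → ℝ) :
    f ∈ superhedgeable ℱ P S t F ↔ (hedges (ℱ t.castSucc) (superhedgeable ℱ P S (t + 1) F)
      (fun θ ω => S θ t.succ ω - S θ t.castSucc ω) f).Nonempty := by
  constructor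
  · rintro ⟨H, hH, hf⟩
    refine ⟨H t, hH t, H, hH, fun θ hθ => ?_⟩
    filter_upwards [hf θ hθ] with ω hω
    rw [tailGain_eq_add] at hω
    linarith
  · rintro ⟨K, hK, H, hH, hf⟩
    refine ⟨_, hH.update hK, fun θ hθ => ?_⟩
    filter_upwards [hf θ hθ] with ω hω
    rw [tailGain_update]
    linarith

/-- Closedness is left as a hypothesis because the backward induction supplies it. -/
theorem isClaimCone_superhedgeable (t : Fin T) (F : Set ι)
    (hcl : ∀ (f : ℕ → ι → Ω → ℝ) (g : ι → Ω → ℝ), (∀ n, f n ∈ superhedgeable ℱ P S (t + 1) F) →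
      (∀ θ ∈ F, ∀ᵐ ω ∂P, Tendsto (fun n => f n θ ω) atTop (𝓝 (g θ ω))) →
        g ∈ superhedgeable ℱ P S (t + 1) F) :
    IsClaimCone (ℱ t.castSucc) P F (superhedgeable ℱ P S (t + 1) F) where
  zero_mem := ⟨fun _ _ => 0, fun _ => stronglyMeasurable_const, fun θ _ =>
    ae_of_all _ fun ω => by simp [tailGain]⟩
  add_mem := by
    rintro f ⟨H, hH, hf⟩ g ⟨K, hK, hg⟩
    refine ⟨fun s ω => H s ω + K s ω, fun s => (hH s).add (hK s), fun θ hθ => ?_⟩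
    filter_upwards [hf θ hθ, hg θ hθ] with ω h1 h2
    rw [tailGain_add]
    exact add_le_add h1 h2
  mul_mem := by
    rintro f ⟨H, hH, hf⟩ a ha ha0
    -- The factor `a` is known only at date `t`, so earlier positions are set to zero to keep the
    -- strategy predictable.
    refine ⟨fun s ω => if (t : ℕ) + 1 ≤ (s : ℕ) then a ω • H s ω else 0,
      IsStrategy.ite (H := fun s ω => a ω • H s ω) fun s hs => ?_, fun θ hθ => ?_⟩
    · refine (ha.mono (ℱ.mono ?_)).smul (hH s)
      exact Fin.castSucc_le_castSucc_iff.2 (Fin.le_def.2 (by omega))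
    · filter_upwards [hf θ hθ] with ω hω
      rw [tailGain_congr (K := fun s ω => a ω • H s ω) _ _ fun s hs => if_pos hs, tailGain_smul]
      exact mul_le_mul_of_nonneg_left hω (ha0 ω)
  mono := by
    rintro f ⟨H, hH, hf⟩ g hg
    refine ⟨H, hH, fun θ hθ => ?_⟩
    filter_upwards [hf θ hθ, hg θ hθ] with ω h1 h2 using h2.trans h1
  closed := hcl

/-- Holding `K` at date `t` and then following the superhedge `H` gains at least zero, hence exactly
zero; so trading `-H` afterwards replicates the gain of `K`. -/
theorem NRAOn.inner_mem_superhedgeable {F : Set ι} (hF : NRAOn ℱ P S F) (t : Fin T)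
    {K : Ω → EuclideanSpace ℝ (Fin d)} (hK : StronglyMeasurable[ℱ t.castSucc] K)
    (h : (fun θ ω => -inner ℝ (K ω) (S θ t.succ ω - S θ t.castSucc ω)) ∈
      superhedgeable ℱ P S (t + 1) F) :
    (fun θ ω => inner ℝ (K ω) (S θ t.succ ω - S θ t.castSucc ω)) ∈
      superhedgeable ℱ P S (t + 1) F := by
  obtain ⟨H, hH, hf⟩ := h
  have h0 := hF _ (IsStrategy.ite (t := t) fun s _ => hH.update hK s) fun θ hθ => by
    filter_upwards [hf θ hθ] with ω hω
    rw [gain_ite, tailGain_update]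
    linarith
  refine ⟨fun s ω => -H s ω, fun s => (hH s).neg, fun θ hθ => ?_⟩
  filter_upwards [h0 θ hθ] with ω hω
  rw [gain_ite, tailGain_update] at hω
  rw [tailGain_neg]
  linarith

/-- Under no robust arbitrage, the superhedgeable payoffs are closed under almost sure limits. -/
theorem NRAOn.superhedgeable_of_tendsto [IsFiniteMeasure P] {F : Set ι} (hF : NRAOn ℱ P S F)
    {t : ℕ} (ht : t ≤ T) (f : ℕ → ι → Ω → ℝ) (g : ι → Ω → ℝ)
    (hf : ∀ n, f n ∈ superhedgeable ℱ P S t F)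
    (hfg : ∀ θ ∈ F, ∀ᵐ ω ∂P, Tendsto (fun n => f n θ ω) atTop (𝓝 (g θ ω))) :
    g ∈ superhedgeable ℱ P S t F := by
  induction ht using Nat.decreasingInduction generalizing f g with
  | self =>
    refine ⟨fun _ _ => 0, fun _ => stronglyMeasurable_const, fun θ hθ => ?_⟩
    have h1 : ∀ᵐ ω ∂P, ∀ n, f n θ ω ≤ 0 := ae_all_iff.2 fun n => by
      obtain ⟨H, -, hH⟩ := hf n
      simpa only [tailGain_last] using hH θ hθ
    filter_upwards [h1, hfg θ hθ] with ω h2 h3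
    rw [tailGain_last]
    exact le_of_tendsto' h3 h2
  | of_succ t ht ih =>
    let s : Fin T := ⟨t, ht⟩
    refine (mem_superhedgeable_iff s F g).2 ?_
    exact (isClaimCone_superhedgeable s F ih).nonempty_hedges_of_tendsto (ℱ.le _) _
      (fun K hK => hF.inner_mem_superhedgeable s hK)
      (fun n => (mem_superhedgeable_iff s F (f n)).1 (hf n)) hfg

/-- Superhedging in all countable families of models containing `D` entails superhedging in all
models simultaneously. -/
theorem superhedgeable_univ_of_countable [IsFiniteMeasure P] {D : Set ι} (hD : D.Countable)
    (hNRA : ∀ F, D ⊆ F → NRAOn ℱ P S F) {t : ℕ} (ht : t ≤ T) (f : ι → Ω → ℝ)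
    (hf : ∀ F : Set ι, F.Countable → D ⊆ F → f ∈ superhedgeable ℱ P S t F) :
    f ∈ superhedgeable ℱ P S t Set.univ := by
  induction ht using Nat.decreasingInduction generalizing f with
  | self =>
    refine ⟨fun _ _ => 0, fun _ => stronglyMeasurable_const, fun θ _ => ?_⟩
    -- At the last date only the sign of `f θ` matters, so each model can be tested separately.
    obtain ⟨H, -, hH⟩ := hf (insert θ D) (hD.insert θ) (Set.subset_insert θ D)
    simpa only [tailGain_last] using hH θ (Set.mem_insert θ D)
  | of_succ t ht ih =>
    let s : Fin T := ⟨t, ht⟩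
    obtain ⟨K, hK⟩ := exists_common_hedge (ℱ.le s.castSucc) hD
      (superhedgeable_antitone (ℱ := ℱ) (P := P) (S := S) (t + 1))
      (fun F hF => isClaimCone_superhedgeable s F ((hNRA F hF).superhedgeable_of_tendsto ht))
      (fun θ ω => S θ s.succ ω - S θ s.castSucc ω) f
      fun F hF hDF => (mem_superhedgeable_iff s F f).1 (hf F hF hDF)
    -- As `K` does not depend on `F`, the residual claim is one and the same for all countable `F`,
    -- and the induction hypothesis applies to it.
    exact (mem_superhedgeable_iff s Set.univ f).2
      ⟨K, (hK D hD subset_rfl).1, ih _ fun F hF hDF => (hK F hF hDF).2⟩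

theorem mem_hedgeable_iff (hS : ∀ θ, StronglyAdapted ℱ (S θ)) (f : Claims ι ℱ P) :
    f ∈ hedgeable ℱ P S ↔
      (fun θ ω => (f θ).1 ω) ∈ superhedgeable ℱ P S 0 Set.univ := by
  constructor
  · rintro ⟨k, ⟨H, hH, hk⟩, h, hh, rfl⟩
    refine ⟨H, hH, fun θ _ => ?_⟩
    filter_upwards [hk θ, hh θ, AEEqFun.coeFn_sub (k θ).1 (h θ).1] with ω h1 h2 h3
    have h4 : ((k - h) θ).1 ω = (k θ).1 ω - (h θ).1 ω := h3
    rw [h4, tailGain_zero]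
    linarith
  · rintro ⟨H, hH, hf⟩
    have hgm : ∀ θ, StronglyMeasurable[ℱ (Fin.last T)] (gain H (S θ)) := by
      intro θ
      refine Finset.stronglyMeasurable_fun_sum _ fun t _ => ?_
      exact ((hH t).mono (ℱ.mono (Fin.le_last _))).inner
        (((hS θ t.succ).mono (ℱ.mono (Fin.le_last _))).sub
          ((hS θ t.castSucc).mono (ℱ.mono (Fin.le_last _))))
    let k : Claims ι ℱ P := fun θ =>
      ⟨AEEqFun.mk _ ((hgm θ).mono (ℱ.le _)).aestronglyMeasurable,
        (hgm θ).aestronglyMeasurable.congr (AEEqFun.coeFn_mk _ _).symm⟩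
    have hk : ∀ θ, ∀ᵐ ω ∂P, (k θ).1 ω = gain H (S θ) ω := fun θ => AEEqFun.coeFn_mk _ _
    refine Set.mem_sub.2 ⟨k, ⟨H, hH, hk⟩, k - f, fun θ => ?_, sub_sub_cancel k f⟩
    filter_upwards [hk θ, hf θ (Set.mem_univ θ), AEEqFun.coeFn_sub (k θ).1 (f θ).1]
      with ω h1 h2 h3
    have h4 : ((k - f) θ).1 ω = (k θ).1 ω - (f θ).1 ω := h3
    rw [tailGain_zero] at h2
    rw [h4]
    linarith

/-! ### Closure in the product topology -/

/-- Sequences in `L⁰` whose distances to `g` are bounded by `2⁻ⁿ` eventually converge almost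
surely. -/
theorem L0.ae_tendsto_of_dist_le {Ω : Type*} {𝒢 m : MeasurableSpace Ω} {P : Measure Ω}
    [IsFiniteMeasure P]
    {f : ℕ → L0 𝒢 P} {g : L0 𝒢 P} (h : ∀ᶠ n in atTop, dist (f n) g ≤ (1 / 2 : ℝ) ^ n) :
    ∀ᵐ ω ∂P, Tendsto (fun n => (f n).1 ω) atTop (𝓝 (g.1 ω)) := by
  have hsum : Summable fun n => dist (f n) g :=
    summable_geometric_two.of_norm_bounded_eventually_nat (by
      filter_upwards [h] with n hn
      rwa [Real.norm_of_nonneg dist_nonneg])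
  have h0 : ∀ n ω, 0 ≤ min 1 |(f n).1 ω - g.1 ω| := fun n ω => le_min zero_le_one (abs_nonneg _)
  have hae : ∀ᵐ ω ∂P, Summable fun n => min 1 |(f n).1 ω - g.1 ω| := by
    have h1 : ∀ n, ∫⁻ ω, ENNReal.ofReal (min 1 |(f n).1 ω - g.1 ω|) ∂P
        = ENNReal.ofReal (dist (f n) g) := fun n =>
      (ofReal_integral_eq_lintegral_ofReal (L0.integrable_min _ _) (ae_of_all _ (h0 n))).symm
    have hm : ∀ n, AEMeasurable (fun ω => ENNReal.ofReal (min 1 |(f n).1 ω - g.1 ω|)) P :=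
      fun n => (L0.integrable_min (f n) g).aestronglyMeasurable.aemeasurable.ennreal_ofReal
    have h2 : ∫⁻ ω, ∑' n, ENNReal.ofReal (min 1 |(f n).1 ω - g.1 ω|) ∂P ≠ ⊤ := by
      rw [lintegral_tsum hm]
      simp only [h1]
      exact hsum.tsum_ofReal_ne_top
    filter_upwards [ae_lt_top' (AEMeasurable.tsum hm) h2] with ω hω
    have h3 := ENNReal.summable_toReal hω.ne
    refine h3.congr fun n => ?_
    exact ENNReal.toReal_ofReal (h0 n ω)
  filter_upwards [hae] with ω hω
  have h1 := hω.tendsto_atTop_zero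
  rw [tendsto_iff_dist_tendsto_zero]
  refine h1.congr' ?_
  filter_upwards [h1.eventually_lt_const zero_lt_one] with n hn
  rw [Real.dist_eq]
  exact min_eq_right ((min_lt_iff.1 hn).resolve_left (lt_irrefl _)).le

theorem superhedgeable_of_mem_closure [IsFiniteMeasure P] (hS : ∀ θ, StronglyAdapted ℱ (S θ))
    {F : Set ι} (hF : F.Countable) (hNRA : NRAOn ℱ P S F) {f : Claims ι ℱ P}
    (hf : f ∈ closure (hedgeable ℱ P S)) :
    (fun θ ω => (f θ).1 ω) ∈ superhedgeable ℱ P S 0 F := by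
  classical
  obtain ⟨e, he⟩ := Set.countable_iff_exists_injOn.1 hF
  have hfin : ∀ n, {θ ∈ F | e θ ≤ n}.Finite := fun n =>
    Set.Finite.of_finite_image ((Set.finite_Iic n).subset (by rintro _ ⟨θ, hθ, rfl⟩; exact hθ.2))
      (he.mono (Set.sep_subset _ _))
  have hseq : ∀ n : ℕ, ∃ u ∈ hedgeable ℱ P S,
      ∀ θ ∈ {θ ∈ F | e θ ≤ n}, dist (u θ) (f θ) ≤ (1 / 2 : ℝ) ^ n := by
    intro n
    -- Only finitely many models are constrained at stage `n`, so this is a product neighbourhood;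
    -- each model of `F` is constrained from stage `e θ` on.
    have hnhds : Set.pi {θ ∈ F | e θ ≤ n} (fun θ => Metric.closedBall (f θ) ((1 / 2 : ℝ) ^ n)) ∈
        𝓝 f := set_pi_mem_nhds (hfin n) fun θ _ => Metric.closedBall_mem_nhds _ (by positivity)
    obtain ⟨u, hu, huC⟩ := mem_closure_iff_nhds.1 hf _ hnhds
    exact ⟨u, huC, fun θ hθ => hu θ hθ⟩
  choose u hu hdist using hseq
  refine hNRA.superhedgeable_of_tendsto (Nat.zero_le T) (fun n θ ω => (u n θ).1 ω) _
    (fun n => superhedgeable_antitone 0 (Set.subset_univ F) ((mem_hedgeable_iff hS _).1 (hu n)))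
    fun θ hθ => L0.ae_tendsto_of_dist_le (f := fun n => u n θ) ?_
  filter_upwards [eventually_ge_atTop (e θ)] with n hn
  exact hdist n θ ⟨hθ, hn⟩

/-- No robust arbitrage passes to every family of models which contains a dense set, when the
models depend continuously on the parameter. -/
theorem NRA.nraOn_of_dense [TopologicalSpace ι] [FirstCountableTopology ι]
    (hcont : ∀ (u : ℕ → ι) (θ : ι), Tendsto u atTop (𝓝 θ) →
      ∃ φ : ℕ → ℕ, StrictMono φ ∧ ∀ t, ∀ᵐ ω ∂P,
        Tendsto (fun k => S (u (φ k)) t ω) atTop (𝓝 (S θ t ω)))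
    (hNRA : NRA ℱ P S) {F : Set ι} (hF : Dense F) : NRAOn ℱ P S F := by
  intro H hH h θ _
  refine hNRA H hH (fun θ => ?_) θ
  obtain ⟨u, huF, hu⟩ := mem_closure_iff_seq_limit.1 (hF θ)
  obtain ⟨φ, -, hφ⟩ := hcont u θ hu
  filter_upwards [ae_all_iff.2 hφ, ae_all_iff.2 fun k => h (u (φ k)) (huF _)] with ω h1 h2
  refine ge_of_tendsto' (x := atTop) (f := fun k => gain H (S (u (φ k))) ω) ?_ h2
  exact tendsto_finsetSum _ fun t _ => tendsto_const_nhds.inner ((h1 _).sub (h1 _))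

end market

end RobustMarket

theorem mainTheorem3 {Ω M : Type*} {m : MeasurableSpace Ω} (P : Measure Ω) [IsProbabilityMeasure P]
    {T d : ℕ} (ℱ : Filtration (Fin (T + 1)) m)
    [MetricSpace M] [TopologicalSpace.SeparableSpace M] (Θ : Set M) (hΘ : IsClosed Θ)
    (S : Θ → Fin (T + 1) → Ω → EuclideanSpace ℝ (Fin d))
    (hS : ∀ θ, StronglyAdapted ℱ (S θ))
    (hcont : ∀ (u : ℕ → Θ) (θ : Θ), Tendsto u atTop (𝓝 θ) →
      ∃ φ : ℕ → ℕ, StrictMono φ ∧ ∀ t, ∀ᵐ ω ∂P,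
        Tendsto (fun k => S (u (φ k)) t ω) atTop (𝓝 (S θ t ω)))
    (hNRA : RobustMarket.NRA ℱ P S) :
    IsClosed (RobustMarket.hedgeable ℱ P S) ∧
      ∀ (I : Type*) [Preorder I] [IsDirectedOrder I] [Nonempty I]
        (f : I → RobustMarket.Claims Θ ℱ P) (g : RobustMarket.Claims Θ ℱ P),
        (∀ α, f α ∈ RobustMarket.hedgeable ℱ P S) → Tendsto f atTop (𝓝 g) →
          g ∈ RobustMarket.hedgeable ℱ P S := by
  have hclosed : IsClosed (RobustMarket.hedgeable ℱ P S) := by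
    refine isClosed_of_closure_subset fun f hf => ?_
    -- Second countability, unlike separability, passes to the subspace `Θ`.
    have : SecondCountableTopology M := UniformSpace.secondCountable_of_separable M
    obtain ⟨D, hD, hDd⟩ := TopologicalSpace.exists_countable_dense Θ
    have hN : ∀ F, D ⊆ F → RobustMarket.NRAOn ℱ P S F := fun F hF =>
      hNRA.nraOn_of_dense hcont (hDd.mono hF)
    exact (RobustMarket.mem_hedgeable_iff hS f).2
      (RobustMarket.superhedgeable_univ_of_countable hD hN (Nat.zero_le T) _ fun F hF hDF =>
        RobustMarket.superhedgeable_of_mem_closure hS hF (hN F hDF) hf)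
  exact ⟨hclosed, fun I _ _ _ f g hf hfg => hclosed.mem_of_tendsto hfg (Eventually.of_forall hf)⟩
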